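/- Let $G$ be a Lie group modelled on a Hausdorff locally convex real vector space (maps between open subsets of locally convex spaces being smooth if all iterated directional derivatives exist and are jointly continuous), with Lie algebra $\mathfrak g$. Let $1\to\mathbb T\to\widehat G\xrightarrow{\,q\,} G\to 1$ be a central extension of $G$ by the circle group $\mathbb T$, i.e. an exact sequence of locally convex Lie groups and smooth homomorphisms such that the image of $\mathbb T$ is central in $\widehat G$ and $q$ is a locally trivial principal $\mathbb T$-bundle. For a complex Hilbert space $\mathcal H$ let $\mathrm U(\mathcal H)$ be its unitary group and $\mathrm{PU}(\mathcal H)=\mathrm U(\mathcal H)/\mathbb T\mathbf 1$. A unitary representation of a locally convex Lie group is called smooth if the vectors with smooth orbit map are dense. Let $\widehat\rho\colon\widehat G\to \mathrm U(\mathcal H)$ and $\widehat\rho'\colon\widehat G\to \mathrm U(\mathcal H')$ be smooth unitary representations with $\widehat\rho(z)=z\mathbf 1$ and $\widehat\rho'(z)=z\mathbf 1$ for all $z\in\mathbb T$, and let $\overline\rho\colon G\to\mathrm{PU}(\mathcal H)$, $\overline\rho'\colon G\to\mathrm{PU}(\mathcal H')$ be the projective unitary representations that they induce. (1) $\overline\rho$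 and $\overline\rho'$ are unitarily equivalent, i.e. there is a unitary transformation $U\colon\mathcal H\to\mathcal H'$ with $\overline U\circ\overline\rho(g)=\overline\rho'(g)\circ\overline U$ for all $g\in G$ (bars denoting classes modulo $\mathbb T$), if and only if there exist a unitary transformation $U\colon\mathcal H\to\mathcal H'$ and a smooth character $\chi\colon G\to\mathbb T$ (a smooth group homomorphism) such that $$\widehat\rho'(\widehat g)=\chi(q(\widehat g))\cdot U\widehat\rho(\widehat g)U^{-1}\qquad\text{for all }\widehat g\in\widehat G.$$ (2) If $\mathfrak g$ is topologically perfect, i.e. the linear span of all brackets $[x,y]$ with $x,y\in\mathfrak g$ is dense in $\mathfrak g$, then every smooth character $\chi\colon G\to\mathbb T$ (in particular every $\chi$ as in (1)) factors through a character $\chi_0\colon\pi_0(G)\to\mathbb T$ of the group of components of $G$. -/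

import Mathlib

/-!
Lie groups modelled on locally convex spaces, their Lie algebras, central extensions by the circle
group, and (projective) unitary representations.

Mathlib's differentiable manifolds are modelled on normed spaces, so the calculus on locally convex
spaces (directional derivatives, Michal-Bastiani smoothness) and the manifolds modelled on such
spaces are set up here.  Charts and atlases are those of Mathlib's `ChartedSpace`.
-/

open Set Filter Topology

namespace LCLie

universe u v

section Calculus

/-- `f` has directional derivative `y` at `x` in the direction `h`:
`y = lim_{t → 0} t⁻¹ (f (x + t h) - f x)`. -/
def HasDirDeriv {E : Type u} {F : Type v} [AddCommGroup E] [Module ℝ E]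
    [AddCommGroup F] [Module ℝ F] [TopologicalSpace F]
    (f : E → F) (x h : E) (y : F) : Prop :=
  Tendsto (fun t : ℝ => t⁻¹ • (f (x + t • h) - f x)) (𝓝[≠] 0) (𝓝 y)

/-- The directional derivative `lim_{t → 0} t⁻¹ (f (x + t h) - f x)` (meaningful when it exists). -/
noncomputable def dirDeriv {E : Type u} {F : Type v} [AddCommGroup E] [Module ℝ E]
    [AddCommGroup F] [Module ℝ F] [TopologicalSpace F]
    (f : E → F) (x h : E) : F :=
  limUnder (𝓝[≠] (0 : ℝ)) (fun t : ℝ => t⁻¹ • (f (x + t • h) - f x))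

/-- `f` is of class `C^k` on the open set `U` of a locally convex space.
`C^0` means continuous; `C^(k+1)` means that `f` is continuous, that all directional derivatives
`Df(x)(h)`, `x ∈ U`, exist, and that `Df : U × E → F` is of class `C^k`.  On open sets this is the
same as existence and joint continuity of the iterated directional derivatives
`D^j f : U × E^j → F` for all `j ≤ k`. -/
def CkOn {F : Type v} [AddCommGroup F] [Module ℝ F] [TopologicalSpace F] :
    ℕ → ∀ {E : Type u} [AddCommGroup E] [Module ℝ E] [TopologicalSpace E],
      (E → F) → Set E → Prop
  | 0, _, _, _, _, f, U => ContinuousOn f U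
  | k + 1, E, _, _, _, f, U =>
      ContinuousOn f U ∧ ∃ f' : E × E → F,
        (∀ x ∈ U, ∀ h : E, HasDirDeriv f x h (f' (x, h))) ∧ CkOn k f' (U ×ˢ (univ : Set E))

/-- `f` is smooth (`C^∞`) on the open set `U` of a locally convex space. -/
def SmoothOn {E : Type u} {F : Type v} [AddCommGroup E] [Module ℝ E] [TopologicalSpace E]
    [AddCommGroup F] [Module ℝ F] [TopologicalSpace F] (f : E → F) (U : Set E) : Prop :=
  ∀ k : ℕ, CkOn k f U

end Calculus

section Manifold

/-- `M` is a smooth manifold modelled on `E`: all changes of charts in the atlas are smooth. -/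
class IsSmoothManifold (E M : Type*) [AddCommGroup E] [Module ℝ E] [TopologicalSpace E]
    [TopologicalSpace M] [ChartedSpace E M] : Prop where
  smoothOn_coord_change : ∀ e ∈ atlas E M, ∀ e' ∈ atlas E M,
    SmoothOn (e' ∘ e.symm) (e.target ∩ e.symm ⁻¹' e'.source)

/-- The map `f : M → N` of manifolds modelled on `E` and `F` is smooth on the open set `U ⊆ M`:
it is continuous on `U` and smooth there in all charts of the two atlases. -/
def IsSmoothMapOn (E F : Type*) {M N : Type*} [AddCommGroup E] [Module ℝ E] [TopologicalSpace E]
    [AddCommGroup F] [Module ℝ F] [TopologicalSpace F]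
    [TopologicalSpace M] [ChartedSpace E M] [TopologicalSpace N] [ChartedSpace F N]
    (f : M → N) (U : Set M) : Prop :=
  ContinuousOn f U ∧ ∀ e ∈ atlas E M, ∀ e' ∈ atlas F N,
    SmoothOn (e' ∘ f ∘ e.symm) (e.target ∩ e.symm ⁻¹' (U ∩ f ⁻¹' e'.source))

/-- The map `f : M → N` of manifolds modelled on `E` and `F` is smooth. -/
def IsSmoothMap (E F : Type*) {M N : Type*} [AddCommGroup E] [Module ℝ E] [TopologicalSpace E]
    [AddCommGroup F] [Module ℝ F] [TopologicalSpace F]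
    [TopologicalSpace M] [ChartedSpace E M] [TopologicalSpace N] [ChartedSpace F N]
    (f : M → N) : Prop :=
  IsSmoothMapOn E F f univ

/-- The product manifold `M × N` is modelled on `E × F`; its charts are the products of charts. -/
@[reducible] def prodCharted (E F M N : Type*) [TopologicalSpace E] [TopologicalSpace F]
    [TopologicalSpace M] [ChartedSpace E M] [TopologicalSpace N] [ChartedSpace F N] :
    ChartedSpace (E × F) (M × N) :=
  prodChartedSpace E M F N

end Manifold

section LieGroup

attribute [local instance] prodCharted

/-- A Lie group modelled on the locally convex space `E`: a group with a smooth manifold structure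
such that multiplication and inversion are smooth. -/
class IsLieGroup (E G : Type*) [AddCommGroup E] [Module ℝ E] [TopologicalSpace E]
    [TopologicalSpace G] [ChartedSpace E G] [Group G] : Prop extends IsSmoothManifold E G where
  smooth_mul : IsSmoothMap (E × E) E (fun p : G × G => p.1 * p.2)
  smooth_inv : IsSmoothMap E E (fun g : G => g⁻¹)

theorem IsLieGroup.isTopologicalGroup (E G : Type*) [AddCommGroup E] [Module ℝ E]
    [TopologicalSpace E] [TopologicalSpace G] [ChartedSpace E G] [Group G] [IsLieGroup E G] :
    IsTopologicalGroup G where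
  continuous_mul := continuousOn_univ.1 (IsLieGroup.smooth_mul (E := E) (G := G)).1
  continuous_inv := continuousOn_univ.1 (IsLieGroup.smooth_inv (E := E) (G := G)).1

/-- The identity component: the path component of `1`, a normal subgroup.  (A manifold modelled on
a locally convex space is locally path connected, so path components are connected components.) -/
def identityComponent (E G : Type*) [AddCommGroup E] [Module ℝ E]
    [TopologicalSpace E] [TopologicalSpace G] [ChartedSpace E G] [Group G] [IsLieGroup E G] :
    Subgroup G :=
  haveI := IsLieGroup.isTopologicalGroup E G
  Subgroup.pathComponentOne G

instance identityComponent_normal (E G : Type*) [AddCommGroup E] [Module ℝ E]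
    [TopologicalSpace E] [TopologicalSpace G] [ChartedSpace E G] [Group G] [IsLieGroup E G] :
    (identityComponent E G).Normal :=
  haveI := IsLieGroup.isTopologicalGroup E G
  Subgroup.Normal.pathComponentOne G

/-- The group `π₀(G)` of (path) components of `G`. -/
abbrev PiZero (E G : Type*) [AddCommGroup E] [Module ℝ E]
    [TopologicalSpace E] [TopologicalSpace G] [ChartedSpace E G] [Group G] [IsLieGroup E G] :
    Type _ :=
  G ⧸ identityComponent E G

/-- The left invariant vector field on `G` with value `w ∈ T_1 G` at `1`, read in the preferred
chart `φ` at `1` (through which `T_1 G` is identified with `E`): its value at the point with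
coordinate `x` is the image of `w` under the tangent map at `1` of left translation by `φ⁻¹ x`. -/
noncomputable def leftInvField {E : Type*} (G : Type*) [AddCommGroup E] [Module ℝ E]
    [TopologicalSpace E] [TopologicalSpace G] [ChartedSpace E G] [Group G] (w : E) (x : E) : E :=
  dirDeriv (fun y : E => chartAt E (1 : G) ((chartAt E (1 : G)).symm x * (chartAt E (1 : G)).symm y))
    (chartAt E (1 : G) 1) w

/-- The Lie bracket on the Lie algebra `𝔤 = T_1 G ≅ E`: the value at `1` of the Lie bracket
`[X, Y] = DY(X) - DX(Y)` of the left invariant vector fields extending the two tangent vectors. -/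
noncomputable def lieBracket {E : Type*} (G : Type*) [AddCommGroup E] [Module ℝ E]
    [TopologicalSpace E] [TopologicalSpace G] [ChartedSpace E G] [Group G] (v w : E) : E :=
  dirDeriv (leftInvField G w) (chartAt E (1 : G) 1) v
    - dirDeriv (leftInvField G v) (chartAt E (1 : G) 1) w

/-- The Lie algebra of `G` is topologically perfect: the commutator algebra `[𝔤, 𝔤]`, i.e. the
linear span of all brackets, is dense in `𝔤`. -/
def IsTopologicallyPerfect (E G : Type*) [AddCommGroup E] [Module ℝ E]
    [TopologicalSpace E] [TopologicalSpace G] [ChartedSpace E G] [Group G] : Prop :=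
  Dense (Submodule.span ℝ {x : E | ∃ v w : E, x = lieBracket G v w} : Set E)

/-- The model space of the circle group `𝕋` as a manifold in Mathlib. -/
abbrev CircleModel : Type := EuclideanSpace ℝ (Fin 1)

/-- A central extension `1 → 𝕋 → Ĝ → G → 1` of Lie groups: an exact sequence of smooth
homomorphisms such that the image of `𝕋` is central and `Ĝ → G` is a locally trivial principal
`𝕋`-bundle. -/
structure CentralExtension (E' E G' G : Type*)
    [AddCommGroup E'] [Module ℝ E'] [TopologicalSpace E']
    [AddCommGroup E] [Module ℝ E] [TopologicalSpace E]
    [TopologicalSpace G'] [ChartedSpace E' G'] [Group G']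
    [TopologicalSpace G] [ChartedSpace E G] [Group G] where
  /-- the inclusion `𝕋 → Ĝ` -/
  incl : Circle →* G'
  /-- the projection `Ĝ → G` -/
  proj : G' →* G
  smooth_incl : IsSmoothMap CircleModel E' incl
  smooth_proj : IsSmoothMap E' E proj
  incl_injective : Function.Injective incl
  proj_surjective : Function.Surjective proj
  ker_proj : proj.ker = incl.range
  central : ∀ (z : Circle) (x : G'), incl z * x = x * incl z
  /-- Around each point of `G` there are a smooth local section `σ` and a smooth fibre coordinate
  `τ`, so that `(h, z) ↦ σ h * z` is a diffeomorphism `U × 𝕋 → proj⁻¹ U`, with inverse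
  `x ↦ (proj x, τ x)`. -/
  locally_trivial : ∀ g : G, ∃ (U : Set G) (σ : G → G') (τ : G' → Circle),
    IsOpen U ∧ g ∈ U ∧ IsSmoothMapOn E E' σ U ∧ (∀ h ∈ U, proj (σ h) = h) ∧
    IsSmoothMapOn E' CircleModel τ (proj ⁻¹' U) ∧
    ∀ x : G', proj x ∈ U → σ (proj x) * incl (τ x) = x

end LieGroup

section Representations

/-- A unitary representation `ρ` of a Lie group is smooth if the vectors with smooth orbit map are
dense. -/
def IsSmoothRep (E : Type*) {G H : Type*} [AddCommGroup E] [Module ℝ E] [TopologicalSpace E]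
    [TopologicalSpace G] [ChartedSpace E G] [Group G]
    [NormedAddCommGroup H] [InnerProductSpace ℂ H] (ρ : G →* (H ≃ₗᵢ[ℂ] H)) : Prop :=
  Dense {ψ : H | IsSmoothMap E H (fun g : G => ρ g ψ)}

/-- The subgroup `𝕋 · 1` of the unitary group `U(H)`. -/
def scalars (H : Type*) [NormedAddCommGroup H] [InnerProductSpace ℂ H] :
    Subgroup (H ≃ₗᵢ[ℂ] H) where
  carrier := {V | ∃ z : Circle, ∀ ψ : H, V ψ = (z : ℂ) • ψ}
  one_mem' := ⟨1, fun ψ => by simp⟩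
  mul_mem' := by
    rintro V W ⟨z, hz⟩ ⟨w, hw⟩
    exact ⟨z * w, fun ψ => by
      change V (W ψ) = _
      rw [hw, hz, smul_smul, Circle.coe_mul]⟩
  inv_mem' := by
    rintro V ⟨z, hz⟩
    refine ⟨z⁻¹, fun ψ => V.injective ?_⟩
    have h1 : V (V⁻¹ ψ) = ψ := V.apply_symm_apply ψ
    rw [h1, hz, smul_smul, ← Circle.coe_mul, mul_inv_cancel, Circle.coe_one, one_smul]

instance scalars_normal (H : Type*) [NormedAddCommGroup H] [InnerProductSpace ℂ H] :
    (scalars H).Normal where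
  conj_mem := by
    rintro V ⟨z, hz⟩ W
    refine ⟨z, fun ψ => ?_⟩
    have h1 : W (W⁻¹ ψ) = ψ := W.apply_symm_apply ψ
    change W (V (W⁻¹ ψ)) = _
    rw [hz, map_smul, h1]

/-- The projective unitary group `PU(H) = U(H) / 𝕋 1`. -/
abbrev PU (H : Type*) [NormedAddCommGroup H] [InnerProductSpace ℂ H] : Type _ :=
  (H ≃ₗᵢ[ℂ] H) ⧸ scalars H

/-- Conjugation `V ↦ U V U⁻¹` by a unitary transformation `U : H → H'`. -/
def conj {H H' : Type*} [NormedAddCommGroup H] [InnerProductSpace ℂ H]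
    [NormedAddCommGroup H'] [InnerProductSpace ℂ H'] (U : H ≃ₗᵢ[ℂ] H') :
    (H ≃ₗᵢ[ℂ] H) →* (H' ≃ₗᵢ[ℂ] H') where
  toFun V := (U.symm.trans V).trans U
  map_one' := by ext ψ; simp
  map_mul' V W := by ext ψ; simp

/-- The isomorphism `PU(H) → PU(H')`, the class of `V` going to the class of `U V U⁻¹`. -/
def conjPU {H H' : Type*} [NormedAddCommGroup H] [InnerProductSpace ℂ H]
    [NormedAddCommGroup H'] [InnerProductSpace ℂ H'] (U : H ≃ₗᵢ[ℂ] H') : PU H →* PU H' :=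
  QuotientGroup.map (scalars H) (scalars H') (conj U) (by
    rintro V ⟨z, hz⟩
    exact ⟨z, fun ψ => by simp [conj, hz]⟩)

/-- Two projective unitary representations of `G` are unitarily equivalent if some unitary
transformation `U : H → H'` satisfies `Ū ∘ ρ(g) = ρ'(g) ∘ Ū` for all `g`. -/
def ProjEquivalent {G H H' : Type*} [Group G] [NormedAddCommGroup H] [InnerProductSpace ℂ H]
    [NormedAddCommGroup H'] [InnerProductSpace ℂ H'] (ρ : G →* PU H) (ρ' : G →* PU H') : Prop :=
  ∃ U : H ≃ₗᵢ[ℂ] H', ∀ g : G, conjPU U (ρ g) = ρ' g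

/-- The projective unitary representation `G → PU(H)` induced by a unitary representation `ρ` of a
central extension `Ĝ` with `ρ(z) = z 1` on `𝕋`: the image of `g` is the class of `ρ(x)` for any
`x ∈ Ĝ` over `g`. -/
noncomputable def projRep {E' E G' G H : Type*}
    [AddCommGroup E'] [Module ℝ E'] [TopologicalSpace E']
    [AddCommGroup E] [Module ℝ E] [TopologicalSpace E]
    [TopologicalSpace G'] [ChartedSpace E' G'] [Group G']
    [TopologicalSpace G] [ChartedSpace E G] [Group G]
    [NormedAddCommGroup H] [InnerProductSpace ℂ H]
    (X : CentralExtension E' E G' G) (ρ : G' →* (H ≃ₗᵢ[ℂ] H))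
    (hρ : ∀ (z : Circle) (ψ : H), ρ (X.incl z) ψ = (z : ℂ) • ψ) : G →* PU H :=
  X.proj.liftOfSurjective X.proj_surjective
    ⟨(QuotientGroup.mk' (scalars H)).comp ρ, by
      rw [X.ker_proj]
      rintro _ ⟨z, rfl⟩
      exact (QuotientGroup.eq_one_iff _).2 ⟨z, hρ z⟩⟩

theorem projRep_proj {E' E G' G H : Type*}
    [AddCommGroup E'] [Module ℝ E'] [TopologicalSpace E']
    [AddCommGroup E] [Module ℝ E] [TopologicalSpace E]
    [TopologicalSpace G'] [ChartedSpace E' G'] [Group G']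
    [TopologicalSpace G] [ChartedSpace E G] [Group G]
    [NormedAddCommGroup H] [InnerProductSpace ℂ H]
    (X : CentralExtension E' E G' G) (ρ : G' →* (H ≃ₗᵢ[ℂ] H))
    (hρ : ∀ (z : Circle) (ψ : H), ρ (X.incl z) ψ = (z : ℂ) • ψ) (x : G') :
    projRep X ρ hρ (X.proj x) = (QuotientGroup.mk (ρ x) : PU H) :=
  MonoidHom.liftOfRightInverse_comp_apply _ _ _ _ x

end Representations

end LCLie

open LCLie

/-! Equivalence: if `U` intertwines the projective representations, then `ρ' x = ζ x • U (ρ x) U⁻¹`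
with `ζ x` in the circle. On a nonzero space `ζ x` is unique, hence multiplicative; it is trivial on
the central circle, where both representations are `z • 1`, so it descends to a character `χ` of `G`
(`exists_character`). For smooth vectors `ψ`, `ψ'` with `⟨U ψ, ψ'⟩ ≠ 0` one has `⟨U (ρ x ψ), ρ' x
ψ'⟩ = χ (q x) ⟨U ψ, ψ'⟩`, so `χ ∘ q` is smooth, and smooth local sections of `q` make `χ` smooth
(`isSmoothMap_character`).

Perfect Lie algebra: the derivative `λ` of a smooth character at `1` is continuous and linear.
Differentiating the left invariance `dχ(X_w) = χ λ(w)` once more and antisymmetrising gives `λ [v,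
w] = 0`, because second derivatives are symmetric (`hasDirDeriv_lieBracket_of_isSmoothMap`). By
density `λ = 0`; by translation the derivative vanishes on a whole chart, so `χ = 1` near `1`. The
kernel is then open, hence closed, and contains the identity component.

The calculus behind both parts rests on `tendsto_slope_of_tendsto_slope`, which yields the chain
rule, additivity of the derivative and symmetry of second derivatives. It requires values in a
normed space, so maps are differentiated after composition into a normed space. -/

namespace LCLie

universe u v w

/-! ### Directional derivatives. -/

section DirDeriv

variable {E : Type u} {F : Type v} [AddCommGroup E] [Module ℝ E]
  [AddCommGroup F] [Module ℝ F] [TopologicalSpace F]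

theorem HasDirDeriv.unique [T2Space F] {f : E → F} {x h : E} {y z : F}
    (hy : HasDirDeriv f x h y) (hz : HasDirDeriv f x h z) : y = z :=
  tendsto_nhds_unique hy hz

theorem HasDirDeriv.dirDeriv_eq [T2Space F] {f : E → F} {x h : E} {y : F}
    (hy : HasDirDeriv f x h y) : dirDeriv f x h = y :=
  hy.limUnder_eq

theorem tendsto_line [TopologicalSpace E] [ContinuousAdd E] [ContinuousSMul ℝ E] (x h : E) :
    Tendsto (fun t : ℝ => x + t • h) (𝓝 0) (𝓝 x) := by
  have : Continuous fun t : ℝ => x + t • h := by fun_prop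
  simpa using this.tendsto 0

theorem HasDirDeriv.congr_of_eventuallyEq [TopologicalSpace E] [ContinuousAdd E]
    [ContinuousSMul ℝ E] {f g : E → F} {x h : E} {y : F} (hy : HasDirDeriv f x h y)
    (hfg : f =ᶠ[𝓝 x] g) : HasDirDeriv g x h y := by
  refine Tendsto.congr' ?_ hy
  filter_upwards [((tendsto_line x h).mono_left nhdsWithin_le_nhds).eventually hfg] with t ht
  rw [ht, hfg.eq_of_nhds]

theorem HasDirDeriv.congr_of_isOpen [TopologicalSpace E] [ContinuousAdd E]
    [ContinuousSMul ℝ E] {f g : E → F} {U : Set E} (hU : IsOpen U) (hfg : EqOn f g U) {x h : E} (hx : x ∈ U)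
    {y : F} (hy : HasDirDeriv f x h y) : HasDirDeriv g x h y :=
  hy.congr_of_eventuallyEq (hfg.eventuallyEq_of_mem (hU.mem_nhds hx))

theorem HasDirDeriv.const (c : F) (x h : E) : HasDirDeriv (fun _ => c) x h 0 := by
  simpa [HasDirDeriv] using tendsto_const_nhds

theorem HasDirDeriv.prodMk {F' : Type*} [AddCommGroup F'] [Module ℝ F'] [TopologicalSpace F']
    {f : E → F} {g : E → F'} {x h : E} {y : F} {z : F'} (hf : HasDirDeriv f x h y)
    (hg : HasDirDeriv g x h z) : HasDirDeriv (fun x => (f x, g x)) x h (y, z) :=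
  Tendsto.prodMk_nhds hf hg

theorem HasDirDeriv.clm_comp {F' : Type*} [AddCommGroup F'] [Module ℝ F'] [TopologicalSpace F']
    (L : F →L[ℝ] F') {f : E → F} {x h : E} {y : F} (hf : HasDirDeriv f x h y) :
    HasDirDeriv (fun x => L (f x)) x h (L y) := by
  refine ((L.continuous.tendsto y).comp hf).congr fun t => ?_
  simp

/-- The two difference quotients coincide, so `F` need not be normed. This is how the `E`-valued
multiplication is differentiated in one factor. -/
theorem HasDirDeriv.comp_affine [TopologicalSpace E] {D : Type*} [AddCommGroup D]
    [Module ℝ D] [TopologicalSpace D]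
    (L : D →L[ℝ] E) (c : E) {f : E → F} {x h : D} {y : F}
    (hf : HasDirDeriv f (L x + c) (L h) y) : HasDirDeriv (fun x => f (L x + c)) x h y := by
  refine Tendsto.congr (fun t => ?_) hf
  simp only [map_add, map_smul]
  congr 3
  abel

theorem HasDirDeriv.of_clm [TopologicalSpace E] [ContinuousAdd E] [ContinuousSMul ℝ E]
    (L : E →L[ℝ] F) (c : F)
    (x h : E) : HasDirDeriv (fun x => L x + c) x h (L h) := by
  refine Tendsto.congr' ?_ tendsto_const_nhds
  filter_upwards [self_mem_nhdsWithin] with t ht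
  have ht : t ≠ 0 := ht
  simp [smul_smul, ht]

/-- Homogeneity is the substitution `t ↦ t * a` and, unlike additivity, needs no continuity of the
derivative. -/
theorem HasDirDeriv.smul_dir [ContinuousConstSMul ℝ F] {f : E → F} {x h : E} {y : F}
    (hf : HasDirDeriv f x h y) (a : ℝ) : HasDirDeriv f x (a • h) (a • y) := by
  rcases eq_or_ne a 0 with rfl | ha
  · simpa [HasDirDeriv] using tendsto_const_nhds
  have h1 : Tendsto (fun t : ℝ => t * a) (𝓝[≠] 0) (𝓝[≠] 0) := by
    refine tendsto_nhdsWithin_of_tendsto_nhds_of_eventually_within _ ?_ ?_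
    · have : Tendsto (fun t : ℝ => t * a) (𝓝 0) (𝓝 (0 * a)) := by
        exact (continuous_id.mul continuous_const).tendsto 0
      rw [zero_mul] at this
      exact this.mono_left nhdsWithin_le_nhds
    · filter_upwards [self_mem_nhdsWithin] with t ht
      exact mul_ne_zero ht ha
  refine ((hf.comp h1).const_smul a).congr fun t => ?_
  simp only [Function.comp, smul_smul, mul_inv]
  congr 1
  field_simp

/-- Opens the way to the one-variable mean value theorems along segments. -/
theorem hasDerivAt_line {F : Type v} [NormedAddCommGroup F] [NormedSpace ℝ F] {f : E → F}
    {x h : E} {t : ℝ} {y : F} (hf : HasDirDeriv f (x + t • h) h y) :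
    HasDerivAt (fun s : ℝ => f (x + s • h)) y t := by
  rw [hasDerivAt_iff_tendsto_slope_zero]
  refine Tendsto.congr (fun s => ?_) hf
  simp only [add_smul, add_assoc]

end DirDeriv

/-! ### Maps of class `C^k`, the chain rule and the symmetry of second derivatives. -/

section Ck

theorem CkOn.continuousOn {E : Type u} {F : Type v} [AddCommGroup E] [Module ℝ E]
    [TopologicalSpace E] [AddCommGroup F] [Module ℝ F] [TopologicalSpace F] {f : E → F}
    {U : Set E} {k : ℕ} (hf : CkOn k f U) : ContinuousOn f U := by
  cases k with
  | zero => exact hf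
  | succ k => exact hf.1

theorem CkOn.mono {F : Type v} [AddCommGroup F] [Module ℝ F] [TopologicalSpace F] :
    ∀ {k : ℕ} {E : Type u} [AddCommGroup E] [Module ℝ E] [TopologicalSpace E] {f : E → F}
      {U V : Set E}, CkOn k f U → V ⊆ U → CkOn k f V
  | 0, _, _, _, _, _, _, _, hf, h => ContinuousOn.mono hf h
  | _ + 1, _, _, _, _, _, _, _, ⟨hc, f', hd, hk⟩, h =>
      ⟨hc.mono h, f', fun x hx => hd x (h hx), hk.mono (prod_mono h subset_rfl)⟩

theorem CkOn.congr {F : Type v} [AddCommGroup F] [Module ℝ F] [TopologicalSpace F]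
    {k : ℕ} {E : Type u} [AddCommGroup E] [Module ℝ E] [TopologicalSpace E] [ContinuousAdd E]
    [ContinuousSMul ℝ E] {f g : E → F} {U : Set E} (hf : CkOn k f U) (hU : IsOpen U)
    (hfg : EqOn f g U) : CkOn k g U := by
  cases k with
  | zero => exact ContinuousOn.congr hf hfg.symm
  | succ k =>
    obtain ⟨hc, f', hd, hk⟩ := hf
    exact ⟨hc.congr hfg.symm, f', fun x hx h => (hd x hx h).congr_of_isOpen hU hfg hx, hk⟩

/-- Replaces the existentially given derivative by one that does not depend on `U`, so that local
derivatives can be glued in `CkOn.of_local`. -/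
theorem CkOn.dirDeriv {E : Type u} {F : Type v} [AddCommGroup E] [Module ℝ E]
    [TopologicalSpace E] [ContinuousAdd E] [ContinuousSMul ℝ E] [AddCommGroup F] [Module ℝ F]
    [TopologicalSpace F] [T2Space F] {f : E → F} {U : Set E} {k : ℕ} (hf : CkOn (k + 1) f U)
    (hU : IsOpen U) :
    (∀ x ∈ U, ∀ h, HasDirDeriv f x h (dirDeriv f x h)) ∧
      CkOn k (fun p : E × E => LCLie.dirDeriv f p.1 p.2) (U ×ˢ univ) := by
  obtain ⟨hc, f', hd, hk⟩ := hf
  have key : ∀ x ∈ U, ∀ h, LCLie.dirDeriv f x h = f' (x, h) := fun x hx h =>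
    (hd x hx h).dirDeriv_eq
  refine ⟨fun x hx h => by rw [key x hx h]; exact hd x hx h, ?_⟩
  exact hk.congr (hU.prod isOpen_univ) fun p hp => (key p.1 hp.1 p.2).symm

theorem CkOn.of_local {F : Type v} [AddCommGroup F] [Module ℝ F] [TopologicalSpace F]
    [T2Space F] : ∀ {k : ℕ} {E : Type u} [AddCommGroup E] [Module ℝ E] [TopologicalSpace E]
      [ContinuousAdd E] [ContinuousSMul ℝ E] {f : E → F} {U : Set E},
      (∀ x ∈ U, ∃ V, IsOpen V ∧ x ∈ V ∧ CkOn k f V) → CkOn k f U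
  | 0, _, _, _, _, _, _, _, _, h => fun x hx => by
      obtain ⟨V, hV, hxV, hc⟩ := h x hx
      exact (ContinuousOn.continuousAt hc (hV.mem_nhds hxV)).continuousWithinAt
  | k + 1, E, _, _, _, _, _, f, U, h => by
      refine ⟨fun x hx => ?_, fun p => LCLie.dirDeriv f p.1 p.2, fun x hx => ?_,
        CkOn.of_local fun p hp => ?_⟩
      · obtain ⟨V, hV, hxV, hc⟩ := h x hx
        exact (hc.1.continuousAt (hV.mem_nhds hxV)).continuousWithinAt
      · obtain ⟨V, hV, hxV, hc⟩ := h x hx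
        exact (hc.dirDeriv hV).1 x hxV
      · obtain ⟨V, hV, hxV, hc⟩ := h p.1 hp.1
        exact ⟨V ×ˢ univ, hV.prod isOpen_univ, ⟨hxV, mem_univ _⟩, (hc.dirDeriv hV).2⟩

theorem CkOn.const {F : Type v} [AddCommGroup F] [Module ℝ F] [TopologicalSpace F] :
    ∀ {k : ℕ} {E : Type u} [AddCommGroup E] [Module ℝ E] [TopologicalSpace E] (c : F)
      (U : Set E), CkOn k (fun _ : E => c) U
  | 0, _, _, _, _, _, _ => continuousOn_const
  | _ + 1, _, _, _, _, c, _ =>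
      ⟨continuousOn_const, fun _ => 0, fun x _ h => HasDirDeriv.const c x h, CkOn.const 0 _⟩

theorem CkOn.prodMk {F : Type v} [AddCommGroup F] [Module ℝ F] [TopologicalSpace F]
    {F' : Type w} [AddCommGroup F'] [Module ℝ F'] [TopologicalSpace F'] :
    ∀ {k : ℕ} {E : Type u} [AddCommGroup E] [Module ℝ E] [TopologicalSpace E] {f : E → F}
      {g : E → F'} {U : Set E}, CkOn k f U → CkOn k g U → CkOn k (fun x => (f x, g x)) U
  | 0, _, _, _, _, _, _, _, hf, hg => ContinuousOn.prodMk hf hg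
  | _ + 1, _, _, _, _, _, _, _, ⟨hfc, f', hfd, hfk⟩, ⟨hgc, g', hgd, hgk⟩ =>
      ⟨hfc.prodMk hgc, fun p => (f' p, g' p),
        fun x hx h => (hfd x hx h).prodMk (hgd x hx h), hfk.prodMk hgk⟩

theorem CkOn.comp_affine {F : Type v} [AddCommGroup F] [Module ℝ F] [TopologicalSpace F] :
    ∀ {k : ℕ} {D : Type w} {E : Type u} [AddCommGroup D] [Module ℝ D] [TopologicalSpace D]
      [AddCommGroup E] [Module ℝ E] [TopologicalSpace E] [ContinuousAdd E] (L : D →L[ℝ] E) (c : E)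
      {f : E → F} {U : Set E}, CkOn k f U →
      CkOn k (fun x => f (L x + c)) ((fun x => L x + c) ⁻¹' U)
  | 0, _, _, _, _, _, _, _, _, _, L, c, _, _, hf =>
      ContinuousOn.comp hf (L.continuous.add continuous_const).continuousOn fun _ hx => hx
  | k + 1, D, E, _, _, _, _, _, _, _, L, c, f, U, ⟨hc, f', hd, hk⟩ => by
      refine ⟨ContinuousOn.comp hc (L.continuous.add continuous_const).continuousOn
        fun _ hx => hx, fun p => f' (L p.1 + c, L p.2),
        fun x hx h => (hd _ hx (L h)).comp_affine L c, ?_⟩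
      have := hk.comp_affine (L.prodMap L) (c, 0)
      simp only [ContinuousLinearMap.coe_prodMap', Prod.map, Prod.mk_add_mk, add_zero] at this
      exact this.mono fun p hp => hp

/-- Strict differentiability of a map `f` with jointly continuous directional derivatives: if the
curves `a` and `c` tend to `x` and their difference quotient tends to `h`, then the difference
quotient of their images tends to the derivative of `f` at `x` in the direction `h`. -/
theorem tendsto_slope_of_tendsto_slope {E : Type u} {F : Type v} [AddCommGroup E] [Module ℝ E]
    [TopologicalSpace E] [ContinuousAdd E] [ContinuousSMul ℝ E] [NormedAddCommGroup F]
    [NormedSpace ℝ F] {f : E → F} {f' : E × E → F} {U : Set E} (hU : IsOpen U)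
    (hd : ∀ x ∈ U, ∀ h, HasDirDeriv f x h (f' (x, h))) (hc : ContinuousOn f' (U ×ˢ univ))
    {l : Filter ℝ} (hl : l ≤ 𝓝[≠] 0) {a c : ℝ → E} {x h : E} (hx : x ∈ U)
    (hax : Tendsto a l (𝓝 x)) (hch : Tendsto (fun t : ℝ => t⁻¹ • (c t - a t)) l (𝓝 h)) :
    Tendsto (fun t : ℝ => t⁻¹ • (f (c t) - f (a t))) l (𝓝 (f' (x, h))) := by
  have hcx : ContinuousAt f' (x, h) :=
    hc.continuousAt ((hU.prod isOpen_univ).mem_nhds ⟨hx, mem_univ _⟩)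
  rw [Metric.tendsto_nhds]
  intro ε hε
  -- Base point and direction both vary with `t`; joint continuity controls `f'` along the whole
  -- segment at once.
  have hev : ∀ᶠ p : ℝ × E × E in 𝓝 (0, x, h), p.2.1 + p.1 • p.2.2 ∈ U ∧
      dist (f' (p.2.1 + p.1 • p.2.2, p.2.2)) (f' (x, h)) < ε / 2 := by
    have h1 : Tendsto (fun p : ℝ × E × E => (p.2.1 + p.1 • p.2.2, p.2.2)) (𝓝 (0, x, h))
        (𝓝 (x, h)) := by
      have : Continuous fun p : ℝ × E × E => (p.2.1 + p.1 • p.2.2, p.2.2) := by fun_prop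
      simpa using this.tendsto (0, x, h)
    exact (h1.eventually ((hU.prod isOpen_univ).mem_nhds ⟨hx, mem_univ _⟩)).and
      (h1.eventually (Metric.tendsto_nhds.1 hcx _ (half_pos hε))) |>.mono
      fun p hp => ⟨hp.1.1, hp.2⟩
  rw [nhds_prod_eq] at hev
  obtain ⟨pa, hpa, pb, hpb, hab⟩ := eventually_prod_iff.1 hev
  obtain ⟨δ, hδ, hball⟩ := Metric.eventually_nhds_iff.1 hpa
  have hsmall : ∀ᶠ t : ℝ in l, dist t 0 < δ :=
    hl (mem_nhdsWithin_of_mem_nhds (Metric.ball_mem_nhds 0 hδ))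
  filter_upwards [(hax.prodMk_nhds hch).eventually hpb, hsmall, hl self_mem_nhdsWithin]
    with t ht htδ ht0
  have ht0 : t ≠ 0 := ht0
  -- With the difference quotient itself as direction, `s ↦ a t + s • k` runs from `a t` to `c t`.
  -- Subtracting `s • f' (x, h)` leaves a function whose derivative is at most `ε / 2`.
  set k := t⁻¹ • (c t - a t) with hk
  have hct : c t = a t + t • k := by simp [hk, smul_smul, ht0]
  have hs : ∀ s ∈ uIcc 0 t, a t + s • k ∈ U ∧
      dist (f' (a t + s • k, k)) (f' (x, h)) < ε / 2 := by
    intro s hs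
    refine hab (hball ?_) ht
    rw [dist_zero_right, Real.norm_eq_abs] at htδ ⊢
    have := abs_sub_left_of_mem_uIcc hs
    simp only [sub_zero] at this
    exact this.trans_lt htδ
  have hderiv : ∀ s ∈ uIcc 0 t, HasDerivWithinAt
      (fun s : ℝ => f (a t + s • k) - s • f' (x, h))
      (f' (a t + s • k, k) - f' (x, h)) (uIcc 0 t) s := fun s hs' => by
    have h2 : HasDerivAt (fun s : ℝ => s • f' (x, h)) (f' (x, h)) s := by
      simpa using (hasDerivAt_id s).smul_const (f' (x, h))
    exact ((hasDerivAt_line (hd _ (hs s hs').1 k)).sub h2).hasDerivWithinAt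
  have hmv := Convex.norm_image_sub_le_of_norm_hasDerivWithin_le hderiv
    (fun s hs' => by rw [← dist_eq_norm]; exact (hs s hs').2.le) (convex_uIcc 0 t)
    left_mem_uIcc right_mem_uIcc
  simp only [zero_smul, add_zero, sub_zero] at hmv
  rw [hct, dist_eq_norm]
  have e1 : t⁻¹ • (f (a t + t • k) - f (a t)) - f' (x, h)
      = t⁻¹ • (f (a t + t • k) - t • f' (x, h) - f (a t)) := by
    simp only [smul_sub, smul_smul, inv_mul_cancel₀ ht0, one_smul]
    abel
  rw [e1, norm_smul, norm_inv]
  have htpos : 0 < ‖t‖ := norm_pos_iff.2 ht0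
  calc ‖t‖⁻¹ * ‖f (a t + t • k) - t • f' (x, h) - f (a t)‖ ≤ ‖t‖⁻¹ * (ε / 2 * ‖t‖) := by
        gcongr
    _ = ε / 2 := by field_simp
    _ < ε := half_lt_self hε

theorem HasDirDeriv.comp {D : Type w} {E : Type u} {F : Type v} [AddCommGroup D] [Module ℝ D]
    [AddCommGroup E] [Module ℝ E]
    [TopologicalSpace E] [ContinuousAdd E] [ContinuousSMul ℝ E] [NormedAddCommGroup F]
    [NormedSpace ℝ F] {f : E → F} {f' : E × E → F} {U : Set E} (hU : IsOpen U)
    (hd : ∀ x ∈ U, ∀ h, HasDirDeriv f x h (f' (x, h))) (hc : ContinuousOn f' (U ×ˢ univ))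
    {g : D → E} {x h : D} {y : E} (hx : g x ∈ U) (hg : HasDirDeriv g x h y) :
    HasDirDeriv (fun x => f (g x)) x h (f' (g x, y)) :=
  tendsto_slope_of_tendsto_slope hU hd hc le_rfl hx tendsto_const_nhds hg

/-- The derivative of a map with jointly continuous directional derivatives is additive. -/
theorem HasDirDeriv.map_add_of_continuousOn {E : Type u} {F : Type v} [AddCommGroup E]
    [Module ℝ E] [TopologicalSpace E] [ContinuousAdd E] [ContinuousSMul ℝ E]
    [NormedAddCommGroup F] [NormedSpace ℝ F] {f : E → F} {f' : E × E → F} {U : Set E}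
    (hU : IsOpen U) (hd : ∀ x ∈ U, ∀ h, HasDirDeriv f x h (f' (x, h)))
    (hc : ContinuousOn f' (U ×ˢ univ)) {x : E} (hx : x ∈ U) (v w : E) :
    f' (x, v + w) = f' (x, v) + f' (x, w) := by
  -- The increment along `v + w` is split at the moving point `x + t • v`, which strict
  -- differentiability allows as a base point.
  have h1 : Tendsto (fun t : ℝ => t⁻¹ • (f (x + t • (v + w)) - f (x + t • v))) (𝓝[≠] 0)
      (𝓝 (f' (x, w))) := by
    refine tendsto_slope_of_tendsto_slope hU hd hc le_rfl hx
      ((tendsto_line x v).mono_left nhdsWithin_le_nhds) ?_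
    refine Tendsto.congr' ?_ tendsto_const_nhds
    filter_upwards [self_mem_nhdsWithin] with t ht
    have ht : t ≠ 0 := ht
    simp [smul_smul, ht]
  refine (hd x hx (v + w)).unique (((hd x hx v).add h1).congr fun t => ?_)
  rw [← smul_add]
  congr 1
  abel

/-- The second directional derivatives of a real valued map of class `C^2` are symmetric. -/
theorem second_dirDeriv_symm_real {E : Type u} [AddCommGroup E] [Module ℝ E]
    [TopologicalSpace E] [ContinuousAdd E] [ContinuousSMul ℝ E] {f : E → ℝ} {f' : E × E → ℝ}
    {f'' : (E × E) × (E × E) → ℝ} {U : Set E} (hU : IsOpen U)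
    (hd : ∀ x ∈ U, ∀ h, HasDirDeriv f x h (f' (x, h)))
    (hd' : ∀ p ∈ U ×ˢ (univ : Set E), ∀ h, HasDirDeriv f' p h (f'' (p, h)))
    (hc : ContinuousOn f'' ((U ×ˢ univ) ×ˢ univ)) {x : E} (hx : x ∈ U) (v w : E) :
    f'' ((x, v), (w, 0)) = f'' ((x, w), (v, 0)) := by
  -- The second difference over the parallelogram is symmetric in `v` and `w`. The mean value
  -- theorem in direction `v` turns it into an increment of `f' (·, v)` along `t • w` from the point
  -- `x + ξ • v`, and strict differentiability of `f'` gives the limit.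
  have key : ∀ v w : E, Tendsto (fun t : ℝ => t⁻¹ * (t⁻¹ *
      (f (x + t • v + t • w) - f (x + t • v) - f (x + t • w) + f x))) (𝓝[>] 0)
      (𝓝 (f'' ((x, v), (w, 0)))) := by
    intro v w
    have hev : ∀ᶠ p : ℝ × ℝ in 𝓝 0, x + p.1 • w + p.2 • v ∈ U ∧ x + p.2 • v ∈ U := by
      have h1 : Continuous fun p : ℝ × ℝ => x + p.1 • w + p.2 • v := by fun_prop
      have h2 : Continuous fun p : ℝ × ℝ => x + p.2 • v := by fun_prop
      exact (h1.continuousAt.eventually (hU.mem_nhds (by simpa using hx))).and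
        (h2.continuousAt.eventually (hU.mem_nhds (by simpa using hx)))
    obtain ⟨δ, hδ, hball⟩ := Metric.eventually_nhds_iff.1 hev
    have hmem : ∀ t ∈ Ioo 0 δ, ∀ s ∈ Icc 0 t, x + t • w + s • v ∈ U ∧ x + s • v ∈ U := by
      intro t ht s hs
      refine @hball (t, s) ?_
      rw [dist_zero_right, Prod.norm_def, Real.norm_of_nonneg ht.1.le, Real.norm_of_nonneg hs.1]
      exact max_lt ht.2 (hs.2.trans_lt ht.2)
    have hmv : ∀ t, ∃ ξ, t ∈ Ioo 0 δ → ξ ∈ Ioo 0 t ∧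
        f' (x + t • w + ξ • v, v) - f' (x + ξ • v, v) =
          t⁻¹ * (f (x + t • v + t • w) - f (x + t • v) - f (x + t • w) + f x) := by
      intro t
      by_cases ht : t ∈ Ioo 0 δ
      · have hder : ∀ s ∈ Icc 0 t, HasDerivAt (fun s : ℝ => f (x + t • w + s • v) - f (x + s • v))
            (f' (x + t • w + s • v, v) - f' (x + s • v, v)) s := fun s hs =>
          (hasDerivAt_line (hd _ (hmem t ht s hs).1 v)).sub
            (hasDerivAt_line (hd _ (hmem t ht s hs).2 v))
        obtain ⟨ξ, hξ, h⟩ := exists_hasDerivAt_eq_slope _ _ ht.1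
          (fun s hs => (hder s hs).continuousAt.continuousWithinAt)
          (fun s hs => hder s (Ioo_subset_Icc_self hs))
        refine ⟨ξ, fun _ => ⟨hξ, ?_⟩⟩
        rw [h, add_right_comm x (t • v)]
        simp only [zero_smul, add_zero, sub_zero]
        ring
      · exact ⟨0, fun h => absurd h ht⟩
    choose ξ hξ using hmv
    have hIoo : ∀ᶠ t : ℝ in 𝓝[>] 0, t ∈ Ioo 0 δ := Ioo_mem_nhdsGT hδ
    have hξ0 : Tendsto ξ (𝓝[>] 0) (𝓝 0) := by
      refine tendsto_of_tendsto_of_tendsto_of_le_of_le' tendsto_const_nhds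
        (tendsto_id.mono_left nhdsWithin_le_nhds) ?_ ?_
      · filter_upwards [hIoo] with t ht using (hξ t ht).1.1.le
      · filter_upwards [hIoo] with t ht using (hξ t ht).1.2.le
    have hlim : Tendsto (fun t : ℝ => t⁻¹ • (f' (x + t • w + ξ t • v, v) - f' (x + ξ t • v, v)))
        (𝓝[>] 0) (𝓝 (f'' ((x, v), (w, 0)))) := by
      refine tendsto_slope_of_tendsto_slope (a := fun t => (x + ξ t • v, v))
        (c := fun t => (x + t • w + ξ t • v, v)) (hU.prod isOpen_univ) hd' hc
        (nhdsWithin_mono _ fun t ht => (ne_of_gt ht : t ≠ 0)) ⟨hx, mem_univ _⟩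
        (((tendsto_line x v).comp hξ0).prodMk_nhds tendsto_const_nhds) ?_
      refine Tendsto.congr' ?_ tendsto_const_nhds
      filter_upwards [self_mem_nhdsWithin] with t ht
      have ht : t ≠ 0 := ne_of_gt ht
      simp [smul_smul, ht, add_right_comm x (t • w)]
    refine hlim.congr' ?_
    filter_upwards [hIoo] with t ht
    rw [(hξ t ht).2, smul_eq_mul]
  refine tendsto_nhds_unique (key v w) ((key w v).congr fun t => ?_)
  rw [add_right_comm x (t • w)]
  ring

/-- The second directional derivatives of a map of class `C^2` are symmetric. -/
theorem second_dirDeriv_symm {E : Type u} {F : Type v} [AddCommGroup E] [Module ℝ E]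
    [TopologicalSpace E] [ContinuousAdd E] [ContinuousSMul ℝ E] [NormedAddCommGroup F]
    [NormedSpace ℝ F] {f : E → F} {f' : E × E → F}
    {f'' : (E × E) × (E × E) → F} {U : Set E} (hU : IsOpen U)
    (hd : ∀ x ∈ U, ∀ h, HasDirDeriv f x h (f' (x, h)))
    (hd' : ∀ p ∈ U ×ˢ (univ : Set E), ∀ h, HasDirDeriv f' p h (f'' (p, h)))
    (hc : ContinuousOn f'' ((U ×ˢ univ) ×ˢ univ)) {x : E} (hx : x ∈ U) (v w : E) :
    f'' ((x, v), (w, 0)) = f'' ((x, w), (v, 0)) := by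
  -- The mean value theorem with equality holds only for real values, so continuous functionals
  -- reduce to that case.
  refine (SeparatingDual.eq_iff_forall_dual_eq (R := ℝ)).2 fun L => ?_
  exact second_dirDeriv_symm_real (f := fun x => L (f x)) (f' := fun p => L (f' p))
    (f'' := fun p => L (f'' p)) hU (fun x hx h => (hd x hx h).clm_comp L)
    (fun p hp h => (hd' p hp h).clm_comp L) (L.continuous.comp_continuousOn hc) hx v w

theorem CkOn.of_succ {F : Type v} [AddCommGroup F] [Module ℝ F] [TopologicalSpace F] :
    ∀ {k : ℕ} {E : Type u} [AddCommGroup E] [Module ℝ E] [TopologicalSpace E] {f : E → F}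
      {U : Set E}, CkOn (k + 1) f U → CkOn k f U
  | 0, _, _, _, _, _, _, hf => hf.1
  | _ + 1, _, _, _, _, _, _, ⟨hc, f', hd, hk⟩ => ⟨hc, f', hd, hk.of_succ⟩

/-- The chain rule for maps of class `C^k`, the outer one with values in a normed space. -/
theorem CkOn.comp {F : Type v} [NormedAddCommGroup F] [NormedSpace ℝ F] :
    ∀ {k : ℕ} {D : Type w} {E : Type u} [AddCommGroup D] [Module ℝ D] [TopologicalSpace D]
      [ContinuousAdd D] [ContinuousSMul ℝ D]
      [AddCommGroup E] [Module ℝ E] [TopologicalSpace E] [ContinuousAdd E] [ContinuousSMul ℝ E]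
      {f : E → F} {g : D → E} {U : Set E} {V : Set D}, CkOn k f U → CkOn k g V → IsOpen U →
      MapsTo g V U → CkOn k (fun x => f (g x)) V
  | 0, _, _, _, _, _, _, _, _, _, _, _, _, _, _, _, _, hf, hg, _, hm =>
      ContinuousOn.comp hf hg hm
  | k + 1, D, E, _, _, _, _, _, _, _, _, _, _, f, g, U, V, ⟨hfc, f', hfd, hfk⟩, hg, hU, hm => by
      have hg0 := hg.of_succ
      obtain ⟨hgc, g', hgd, hgk⟩ := hg
      refine ⟨hfc.comp hgc hm, fun p => f' (g p.1, g' p), fun x hx h =>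
        HasDirDeriv.comp hU hfd hfk.continuousOn (hm hx) (hgd x hx h), ?_⟩
      have h1 : CkOn k (fun p : D × D => g p.1) (V ×ˢ univ) := by
        have := hg0.comp_affine (ContinuousLinearMap.fst ℝ D D) 0
        simp only [ContinuousLinearMap.coe_fst', add_zero] at this
        exact this.mono fun p hp => hp.1
      exact hfk.comp (h1.prodMk hgk) (hU.prod isOpen_univ) fun p hp => ⟨hm hp.1, mem_univ _⟩

/-- Brings in smoothness from normed calculus, for the charts of the circle and the inner product.
-/
theorem CkOn.of_contDiffOn {F : Type v} [NormedAddCommGroup F] [NormedSpace ℝ F] :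
    ∀ {k : ℕ} {E : Type u} [NormedAddCommGroup E] [NormedSpace ℝ E] {f : E → F} {U : Set E},
      ContDiffOn ℝ k f U → IsOpen U → CkOn k f U
  | 0, _, _, _, _, _, hf, _ => hf.continuousOn
  | k + 1, E, _, _, f, U, hf, hU => by
      refine ⟨hf.continuousOn, fun p => fderiv ℝ f p.1 p.2, fun x hx h => ?_,
        CkOn.of_contDiffOn ?_ (hU.prod isOpen_univ)⟩
      · have h1 : HasFDerivAt f (fderiv ℝ f x) x :=
          ((hf.differentiableOn (by simp)).differentiableAt (hU.mem_nhds hx)).hasFDerivAt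
        have h2 := (h1.hasLineDerivAt h)
        exact hasDerivAt_iff_tendsto_slope_zero.1 h2 |>.congr fun t => by simp
      · have h1 : ContDiffOn ℝ k (fderiv ℝ f) U := hf.fderiv_of_isOpen hU (by simp)
        exact (h1.comp contDiffOn_fst fun p hp => hp.1).clm_apply contDiffOn_snd

end Ck

/-! ### Smooth maps of manifolds. -/

section Manifolds

variable {E F M : Type*} [AddCommGroup E] [Module ℝ E] [TopologicalSpace E]
  [TopologicalSpace M] [ChartedSpace E M]

theorem SmoothOn.comp {D E F : Type*} [AddCommGroup D] [Module ℝ D] [TopologicalSpace D]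
    [ContinuousAdd D] [ContinuousSMul ℝ D] [AddCommGroup E] [Module ℝ E] [TopologicalSpace E]
    [ContinuousAdd E] [ContinuousSMul ℝ E] [NormedAddCommGroup F] [NormedSpace ℝ F]
    {f : E → F} {g : D → E} {U : Set E} {V : Set D} (hf : SmoothOn f U) (hg : SmoothOn g V)
    (hU : IsOpen U) (hm : MapsTo g V U) : SmoothOn (fun x => f (g x)) V :=
  fun k => (hf k).comp (hg k) hU hm

theorem SmoothOn.of_contDiffOn {E F : Type*} [NormedAddCommGroup E] [NormedSpace ℝ E]
    [NormedAddCommGroup F] [NormedSpace ℝ F] {f : E → F} {U : Set E}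
    (hf : ∀ k : ℕ, ContDiffOn ℝ k f U) (hU : IsOpen U) : SmoothOn f U :=
  fun k => CkOn.of_contDiffOn (hf k) hU

/-- Smoothness of a map into a model space needs to be tested in charts of the source only. -/
theorem isSmoothMapOn_iff_smoothOn [AddCommGroup F] [Module ℝ F] [TopologicalSpace F]
    {f : M → F} {U : Set M} : IsSmoothMapOn E F f U ↔
      ContinuousOn f U ∧ ∀ e ∈ atlas E M, SmoothOn (f ∘ e.symm) (e.target ∩ e.symm ⁻¹' U) := by
  refine and_congr_right fun _ => forall₂_congr fun e _ => ?_
  simp [chartedSpaceSelf_atlas]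

theorem IsSmoothMapOn.of_local [ContinuousAdd E] [ContinuousSMul ℝ E] [AddCommGroup F]
    [Module ℝ F] [TopologicalSpace F] [T2Space F] {f : M → F}
    (h : ∀ x, ∃ U, IsOpen U ∧ x ∈ U ∧ IsSmoothMapOn E F f U) : IsSmoothMap E F f := by
  refine isSmoothMapOn_iff_smoothOn.2 ⟨continuousOn_univ.2 ?_, fun e he k =>
    CkOn.of_local fun x hx => ?_⟩
  · refine continuous_iff_continuousAt.2 fun x => ?_
    obtain ⟨U, hU, hxU, hf⟩ := h x
    exact hf.1.continuousAt (hU.mem_nhds hxU)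
  · obtain ⟨U, hU, hxU, hf⟩ := h (e.symm x)
    exact ⟨_, e.isOpen_inter_preimage_symm hU, ⟨hx.1, hxU⟩,
      (isSmoothMapOn_iff_smoothOn.1 hf).2 e he k⟩

/-- Compositions of smooth maps are smooth, if the last map has values in a normed space. -/
theorem IsSmoothMapOn.comp [ContinuousAdd E] [ContinuousSMul ℝ E] {E₂ N : Type*}
    [AddCommGroup E₂] [Module ℝ E₂] [TopologicalSpace E₂] [ContinuousAdd E₂] [ContinuousSMul ℝ E₂]
    [TopologicalSpace N] [ChartedSpace E₂ N] [NormedAddCommGroup F] [NormedSpace ℝ F]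
    {f : N → F} {g : M → N} {U : Set M} {W : Set N} (hf : IsSmoothMapOn E₂ F f W)
    (hg : IsSmoothMapOn E E₂ g U) (hU : IsOpen U) (hW : IsOpen W) (hm : MapsTo g U W) :
    IsSmoothMapOn E F (fun x => f (g x)) U := by
  rw [isSmoothMapOn_iff_smoothOn] at hf
  refine isSmoothMapOn_iff_smoothOn.2 ⟨hf.1.comp hg.1 hm, fun e he k => CkOn.of_local ?_⟩
  intro x hx
  set e' := chartAt E₂ (g (e.symm x))
  have hV : IsOpen (e.target ∩ e.symm ⁻¹' (U ∩ g ⁻¹' e'.source)) :=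
    e.isOpen_inter_preimage_symm (hg.1.isOpen_inter_preimage hU e'.open_source)
  refine ⟨_, hV, ⟨hx.1, hx.2, mem_chart_source _ _⟩, ?_⟩
  have h1 := hg.2 e he e' (chart_mem_atlas _ _) k
  have h2 := hf.2 e' (chart_mem_atlas _ _) k
  refine (h2.comp h1 (e'.isOpen_inter_preimage_symm hW) ?_).congr hV ?_
  · intro y hy
    refine ⟨e'.map_source hy.2.2, ?_⟩
    simpa [e'.left_inv hy.2.2] using hm hy.2.1
  · intro y hy
    simp [e'.left_inv hy.2.2]

theorem IsSmoothMap.const [AddCommGroup F] [Module ℝ F] [TopologicalSpace F]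
    {N : Type*} [TopologicalSpace N] [ChartedSpace F N] (c : N) :
    IsSmoothMap E F (fun _ : M => c) :=
  ⟨continuousOn_const, fun _ _ e' _ _ => CkOn.const (e' c) _⟩

end Manifolds

/-! ### Circle-valued maps as complex-valued maps. -/

section Circle

attribute [local instance] finrank_real_complex_fact'

theorem exists_eq_stereographic_of_mem_atlas
    {e : OpenPartialHomeomorph Circle CircleModel} (he : e ∈ atlas CircleModel Circle) :
    ∃ v : Metric.sphere (0 : ℂ) 1, e = stereographic' 1 v :=
  he

/-- Inverse stereographic projection is rational in `x`, with denominator `‖x‖ ^ 2 + 4` that never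
vanishes. -/
theorem isSmoothMap_circle_coe : IsSmoothMap CircleModel ℂ (fun z : Circle => (z : ℂ)) := by
  refine isSmoothMapOn_iff_smoothOn.2 ⟨(by fun_prop), fun e he => ?_⟩
  obtain ⟨v, rfl⟩ := exists_eq_stereographic_of_mem_atlas he
  have h0 : (stereographic' 1 v).target = univ := stereographic'_target v
  refine SmoothOn.of_contDiffOn (fun k => ContDiff.contDiffOn ?_) ?_
  · change ContDiff ℝ k fun x => ((stereographic' 1 v).symm x : ℂ)
    simp only [stereographic'_symm_apply]
    have h2 : ∀ x : ℂ, ‖x‖ ^ 2 + 4 ≠ 0 := fun x => by positivity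
    have h3 : ContDiff ℝ k fun x : CircleModel =>
        (((OrthonormalBasis.fromOrthogonalSpanSingleton 1
          (ne_zero_of_mem_unit_sphere v)).repr.symm x : (Submodule.span ℝ {(v : ℂ)})ᗮ) : ℂ) := by
      let U : (Submodule.span ℝ {(v : ℂ)})ᗮ ≃ₗᵢ[ℝ] CircleModel :=
        (OrthonormalBasis.fromOrthogonalSpanSingleton 1 (ne_zero_of_mem_unit_sphere v)).repr
      exact (Submodule.subtypeL (Submodule.span ℝ {(v : ℂ)})ᗮ).contDiff.comp U.symm.contDiff
    have h4 := (h3.norm_sq ℝ (E := ℂ))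
    have h5 := (h4.add (contDiff_const (c := (4 : ℝ)))).inv fun x => h2 _
    exact (h5.smul (contDiff_const.smul h3)).add
      (h5.smul ((h4.sub contDiff_const).smul contDiff_const))
  · rw [h0, preimage_univ, inter_univ]
    exact isOpen_univ

theorem IsSmoothMap.coe_circle {E M : Type*} [AddCommGroup E] [Module ℝ E] [TopologicalSpace E]
    [ContinuousAdd E] [ContinuousSMul ℝ E] [TopologicalSpace M] [ChartedSpace E M]
    {χ : M → Circle} (h : IsSmoothMap E CircleModel χ) :
    IsSmoothMap E ℂ (fun x => (χ x : ℂ)) :=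
  IsSmoothMapOn.comp isSmoothMap_circle_coe h isOpen_univ isOpen_univ (mapsTo_univ _ _)

/-- A map into the circle is smooth if it is smooth as a complex valued map. -/
theorem IsSmoothMap.of_coe_circle {E M : Type*} [AddCommGroup E] [Module ℝ E]
    [TopologicalSpace E] [ContinuousAdd E] [ContinuousSMul ℝ E] [TopologicalSpace M]
    [ChartedSpace E M] {χ : M → Circle} (h : IsSmoothMap E ℂ (fun x => (χ x : ℂ))) :
    IsSmoothMap E CircleModel χ := by
  obtain ⟨hc, hs⟩ := isSmoothMapOn_iff_smoothOn.1 h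
  have hχ : Continuous χ := continuous_induced_rng.2 (continuousOn_univ.1 hc)
  refine ⟨hχ.continuousOn, fun e he e' he' => ?_⟩
  obtain ⟨v, rfl⟩ := exists_eq_stereographic_of_mem_atlas he'
  -- On this open subset of `ℂ` the stereographic formula is smooth; it meets the circle exactly off
  -- the pole `v`, as unit vectors with inner product `1` are equal.
  have hW : IsOpen {z : ℂ | innerSL ℝ (v : ℂ) z ≠ (1 : ℝ)} :=
    isOpen_ne_fun (innerSL ℝ (v : ℂ)).continuous continuous_const
  have hS : SmoothOn (fun z : ℂ => (OrthonormalBasis.fromOrthogonalSpanSingleton 1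
      (ne_zero_of_mem_unit_sphere v)).repr (stereoToFun (v : ℂ) z))
      {z : ℂ | innerSL ℝ (v : ℂ) z ≠ (1 : ℝ)} := by
    refine SmoothOn.of_contDiffOn (fun k => ?_) ?_
    · exact (LinearIsometryEquiv.contDiff _).comp_contDiffOn contDiffOn_stereoToFun
    · exact hW
  have hg : SmoothOn ((fun x => (χ x : ℂ)) ∘ e.symm)
      (e.target ∩ e.symm ⁻¹' (univ ∩ χ ⁻¹' (stereographic' 1 v).source)) :=
    fun k => (hs e he k).mono fun x hx => ⟨hx.1, trivial⟩
  refine hS.comp hg hW ?_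
  intro x hx h1
  have h2 : χ (e.symm x) ∈ (stereographic' 1 v).source := hx.2.2
  have h3 : (χ (e.symm x) : Metric.sphere (0 : ℂ) 1) ∈ ({v}ᶜ : Set _) := by
    rw [← stereographic'_source (n := 1) v]; exact h2
  apply h3
  have h4 : inner ℝ (v : ℂ) (χ (e.symm x) : ℂ) = 1 := h1
  rw [inner_eq_one_iff_of_norm_eq_one (norm_eq_of_mem_sphere v) (Circle.norm_coe _)] at h4
  exact Subtype.ext h4.symm

end Circle

/-! ### The character relating two representations. -/

section Characters

variable {E' E G' G H H' : Type*}
  [AddCommGroup E'] [Module ℝ E'] [TopologicalSpace E']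
  [AddCommGroup E] [Module ℝ E] [TopologicalSpace E]
  [TopologicalSpace G'] [ChartedSpace E' G'] [Group G']
  [TopologicalSpace G] [ChartedSpace E G] [Group G]
  [NormedAddCommGroup H] [InnerProductSpace ℂ H]
  [NormedAddCommGroup H'] [InnerProductSpace ℂ H']

/-- A map on the base of a central extension is smooth if its pull back is. -/
theorem CentralExtension.isSmoothMap_of_comp_proj [ContinuousAdd E] [ContinuousSMul ℝ E]
    [ContinuousAdd E'] [ContinuousSMul ℝ E']
    (X : CentralExtension E' E G' G) {F : Type*} [NormedAddCommGroup F] [NormedSpace ℝ F]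
    {f : G → F} (hf : IsSmoothMap E' F fun x => f (X.proj x)) : IsSmoothMap E F f := by
  refine IsSmoothMapOn.of_local fun g => ?_
  -- Only the section is needed: `f = (f ∘ q) ∘ σ` on `V`.
  obtain ⟨V, σ, -, hV, hgV, hσ, hσV, -⟩ := X.locally_trivial g
  refine ⟨V, hV, hgV, ?_⟩
  obtain ⟨hc, hs⟩ := isSmoothMapOn_iff_smoothOn.1
    (IsSmoothMapOn.comp hf hσ hV isOpen_univ (mapsTo_univ _ _))
  have hEq : EqOn (fun h => f (X.proj (σ h))) f V := fun h hh => by simp only [hσV h hh]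
  refine isSmoothMapOn_iff_smoothOn.2 ⟨hc.congr hEq.symm, fun e he k => ?_⟩
  exact (hs e he k).congr (e.isOpen_inter_preimage_symm hV) fun x hx => hEq hx.2

theorem conjPU_mk_eq_mk_iff (U : H ≃ₗᵢ[ℂ] H') (V : H ≃ₗᵢ[ℂ] H) (W : H' ≃ₗᵢ[ℂ] H') :
    conjPU U (QuotientGroup.mk V) = (QuotientGroup.mk W : PU H') ↔
      ∃ z : Circle, ∀ ψ, W ψ = (z : ℂ) • U (V (U.symm ψ)) := by
  have h0 : conjPU U (QuotientGroup.mk V) = (QuotientGroup.mk (conj U V) : PU H') := rfl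
  rw [h0, QuotientGroup.eq]
  refine exists_congr fun z => forall_congr' fun ψ => ?_
  have h1 : ((conj U V)⁻¹ * W) ψ = (conj U V).symm (W ψ) := rfl
  have h2 : conj U V ψ = U (V (U.symm ψ)) := rfl
  rw [h1, LinearIsometryEquiv.symm_apply_eq, map_smul, h2]

theorem projEquivalent_projRep_iff (X : CentralExtension E' E G' G)
    (ρ : G' →* (H ≃ₗᵢ[ℂ] H)) (ρ' : G' →* (H' ≃ₗᵢ[ℂ] H'))
    (hρ : ∀ (z : Circle) (ψ : H), ρ (X.incl z) ψ = (z : ℂ) • ψ)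
    (hρ' : ∀ (z : Circle) (ψ : H'), ρ' (X.incl z) ψ = (z : ℂ) • ψ) :
    ProjEquivalent (projRep X ρ hρ) (projRep X ρ' hρ') ↔
      ∃ U : H ≃ₗᵢ[ℂ] H', ∀ x, ∃ z : Circle, ∀ ψ, ρ' x ψ = (z : ℂ) • U (ρ x (U.symm ψ)) := by
  refine exists_congr fun U => ?_
  rw [X.proj_surjective.forall]
  refine forall_congr' fun x => ?_
  rw [projRep_proj, projRep_proj, conjPU_mk_eq_mk_iff]

theorem circle_eq_of_smul_eq {z w : Circle} {ψ : H} (hψ : ψ ≠ 0)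
    (h : (z : ℂ) • ψ = (w : ℂ) • ψ) : z = w :=
  Circle.ext (smul_left_injective ℂ hψ h)

/-- If two unitary representations of a central extension differ, after a unitary transformation,
by scalars, then they differ by a character of the base. -/
theorem exists_character [Nontrivial H'] (X : CentralExtension E' E G' G)
    (ρ : G' →* (H ≃ₗᵢ[ℂ] H)) (ρ' : G' →* (H' ≃ₗᵢ[ℂ] H'))
    (hρ : ∀ (z : Circle) (ψ : H), ρ (X.incl z) ψ = (z : ℂ) • ψ)
    (hρ' : ∀ (z : Circle) (ψ : H'), ρ' (X.incl z) ψ = (z : ℂ) • ψ) (U : H ≃ₗᵢ[ℂ] H')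
    (hU : ∀ x, ∃ z : Circle, ∀ ψ, ρ' x ψ = (z : ℂ) • U (ρ x (U.symm ψ))) :
    ∃ χ : G →* Circle, ∀ x ψ, ρ' x ψ = (χ (X.proj x) : ℂ) • U (ρ x (U.symm ψ)) := by
  choose ζ hζ using hU
  obtain ⟨ψ₀, hψ₀⟩ := exists_ne (0 : H')
  have hne : ∀ x, U (ρ x (U.symm ψ₀)) ≠ 0 := fun x => by simpa using hψ₀
  have hmul : ∀ x y, ζ (x * y) = ζ x * ζ y := fun x y => by
    refine circle_eq_of_smul_eq (hne (x * y)) ?_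
    rw [← hζ, map_mul, map_mul]
    change ρ' x (ρ' y ψ₀) = _ • U (ρ x (ρ y (U.symm ψ₀)))
    rw [hζ x, hζ y, map_smul, map_smul, map_smul, U.symm_apply_apply, smul_smul, Circle.coe_mul]
  have hker : ∀ z, ζ (X.incl z) = 1 := fun z => by
    refine circle_eq_of_smul_eq (hne (X.incl z)) ?_
    rw [← hζ, hρ', hρ, map_smul, U.apply_symm_apply, Circle.coe_one, one_smul]
  let Z : G' →* Circle := MonoidHom.mk' ζ hmul
  let χ : G →* Circle := X.proj.liftOfSurjective X.proj_surjective ⟨Z, by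
    rw [X.ker_proj]
    rintro _ ⟨z, rfl⟩
    exact hker z⟩
  refine ⟨χ, fun x ψ => ?_⟩
  have : χ (X.proj x) = ζ x := MonoidHom.liftOfRightInverse_comp_apply _ _ _ _ x
  rw [this, hζ]

/-- The inner product is smooth over `ℝ` on the pair of orbit maps. Both vectors must be smooth,
since both arguments move with `x`. -/
theorem isSmoothMap_of_matrix_coefficient [ContinuousAdd E'] [ContinuousSMul ℝ E']
    {ρ : G' →* (H ≃ₗᵢ[ℂ] H)}
    {ρ' : G' →* (H' ≃ₗᵢ[ℂ] H')} {ψ : H} {ψ' : H'} (U : H ≃ₗᵢ[ℂ] H') (c : ℂ)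
    (hψ : IsSmoothMap E' H fun x => ρ x ψ) (hψ' : IsSmoothMap E' H' fun x => ρ' x ψ') :
    IsSmoothMap E' ℂ fun x => c * inner ℂ (U (ρ x ψ)) (ρ' x ψ') := by
  have hUc : ∀ k : ℕ, ContDiff ℝ k (fun a : H => U a) := fun k =>
    U.contDiff.restrict_scalars ℝ
  have hB : SmoothOn (fun p : H × H' => c * inner ℂ (U p.1) p.2) univ := by
    refine SmoothOn.of_contDiffOn (fun k => ContDiff.contDiffOn ?_) isOpen_univ
    exact contDiff_const.mul (((hUc k).comp contDiff_fst).inner ℂ contDiff_snd)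
  obtain ⟨hc, hs⟩ := isSmoothMapOn_iff_smoothOn.1 hψ
  obtain ⟨hc', hs'⟩ := isSmoothMapOn_iff_smoothOn.1 hψ'
  refine isSmoothMapOn_iff_smoothOn.2 ⟨?_, fun e he => ?_⟩
  · exact continuousOn_const.mul ((U.continuous.comp_continuousOn hc).inner hc')
  · have hp : SmoothOn (fun y => (ρ (e.symm y) ψ, ρ' (e.symm y) ψ'))
        (e.target ∩ e.symm ⁻¹' univ) := fun k => (hs e he k).prodMk (hs' e he k)
    exact hB.comp hp isOpen_univ (mapsTo_univ _ _)

/-- The character relating two smooth representations of a central extension is smooth. -/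
theorem isSmoothMap_character [ContinuousAdd E] [ContinuousSMul ℝ E]
    [ContinuousAdd E'] [ContinuousSMul ℝ E'] [Nontrivial H'] (X : CentralExtension E' E G' G)
    {ρ : G' →* (H ≃ₗᵢ[ℂ] H)} {ρ' : G' →* (H' ≃ₗᵢ[ℂ] H')}
    (hρs : IsSmoothRep E' ρ) (hρs' : IsSmoothRep E' ρ') {U : H ≃ₗᵢ[ℂ] H'} {χ : G →* Circle}
    (hχ : ∀ x ψ, ρ' x ψ = (χ (X.proj x) : ℂ) • U (ρ x (U.symm ψ))) :
    IsSmoothMap E CircleModel χ := by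
  obtain ⟨ψ₀, hψ₀⟩ := exists_ne (0 : H')
  -- Density gives a nonzero smooth `ψ`, then a smooth `ψ'` in the open set `⟨U ψ, ·⟩ ≠ 0`, which
  -- contains `U ψ`.
  obtain ⟨ψ, hψ, hψ0⟩ := hρs.exists_mem_open (isOpen_compl_singleton (x := (0 : H)))
    ⟨U.symm ψ₀, by simpa using hψ₀⟩
  obtain ⟨ψ', hψ', hψ'0⟩ := hρs'.exists_mem_open
    (isOpen_ne_fun (f := fun φ : H' => inner ℂ (U ψ) φ) (g := fun _ => 0)
      (by fun_prop) continuous_const) ⟨U ψ, by simpa using hψ0⟩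
  apply IsSmoothMap.of_coe_circle
  apply X.isSmoothMap_of_comp_proj
  have hEq : (fun x => (χ (X.proj x) : ℂ)) = fun x =>
      (inner ℂ (U ψ) ψ')⁻¹ * inner ℂ (U (ρ x ψ)) (ρ' x ψ') := by
    funext x
    have h1 : inner ℂ (U (ρ x ψ)) (ρ' x ψ') = (χ (X.proj x) : ℂ) * inner ℂ (U ψ) ψ' := by
      rw [hχ, inner_smul_right, U.inner_map_map, (ρ x).inner_map_map, ← U.inner_map_map,
        U.apply_symm_apply]
    have h2 : inner ℂ (U ψ) ψ' ≠ 0 := hψ'0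
    rw [h1, mul_comm, mul_assoc, mul_inv_cancel₀ h2, mul_one]
  rw [hEq]
  exact isSmoothMap_of_matrix_coefficient U _ hψ hψ'

end Characters

/-! ### Smooth characters and topologically perfect Lie algebras. -/

section Perfect

/-- The first two derivatives, in a chart, of a smooth map into the circle. -/
theorem exists_derivs_of_isSmoothMap {E G : Type*} [AddCommGroup E] [Module ℝ E]
    [TopologicalSpace E] [ContinuousAdd E] [ContinuousSMul ℝ E] [TopologicalSpace G]
    [ChartedSpace E G] {χ : G → Circle} (hχ : IsSmoothMap E CircleModel χ)
    {e : OpenPartialHomeomorph G E} (he : e ∈ atlas E G) :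
    ∃ (f' : E × E → ℂ) (f'' : (E × E) × (E × E) → ℂ),
      (∀ x ∈ e.target, ∀ h, HasDirDeriv (fun x => (χ (e.symm x) : ℂ)) x h (f' (x, h))) ∧
      ContinuousOn f' (e.target ×ˢ univ) ∧
      (∀ p ∈ e.target ×ˢ (univ : Set E), ∀ h, HasDirDeriv f' p h (f'' (p, h))) ∧
      ContinuousOn f'' ((e.target ×ˢ univ) ×ˢ univ) := by
  obtain ⟨-, f', hd, hc, f'', hd', hc'⟩ :=
    (isSmoothMapOn_iff_smoothOn.1 hχ.coe_circle).2 e he 2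
  simp only [preimage_univ, inter_univ] at hd hc hd' hc'
  exact ⟨f', f'', hd, hc, hd', hc'⟩

variable {E G : Type*} [AddCommGroup E] [Module ℝ E] [TopologicalSpace E]
  [TopologicalSpace G] [ChartedSpace E G] [Group G]

/-- The multiplication of a Lie group, read in the charts `e` and `e'` of the factors and `e''`. -/
theorem smoothOn_mul_charts [IsLieGroup E G] {e e' e'' : OpenPartialHomeomorph G E}
    (he : e ∈ atlas E G) (he' : e' ∈ atlas E G) (he'' : e'' ∈ atlas E G) :
    IsOpen {p : E × E | p.1 ∈ e.target ∧ p.2 ∈ e'.target ∧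
      e.symm p.1 * e'.symm p.2 ∈ e''.source} ∧
    SmoothOn (fun p : E × E => e'' (e.symm p.1 * e'.symm p.2))
      {p : E × E | p.1 ∈ e.target ∧ p.2 ∈ e'.target ∧
        e.symm p.1 * e'.symm p.2 ∈ e''.source} := by
  have hmul := IsLieGroup.smooth_mul (E := E) (G := G)
  have hset : {p : E × E | p.1 ∈ e.target ∧ p.2 ∈ e'.target ∧
      e.symm p.1 * e'.symm p.2 ∈ e''.source} = (e.prod e').target ∩
        (e.prod e').symm ⁻¹' (univ ∩ (fun p : G × G => p.1 * p.2) ⁻¹' e''.source) := by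
    ext p
    simp [and_assoc]
  rw [hset]
  constructor
  · refine (e.prod e').isOpen_inter_preimage_symm ?_
    rw [univ_inter]
    exact e''.open_source.preimage (continuousOn_univ.1 hmul.1)
  · exact hmul.2 (e.prod e') (mem_image2_of_mem he he') e'' he''

/-- A character with open kernel is trivial on the identity component. -/
theorem identityComponent_le_ker [IsLieGroup E G] {χ : G →* Circle}
    (h : IsOpen (χ.ker : Set G)) : identityComponent E G ≤ χ.ker := by
  have := IsLieGroup.isTopologicalGroup E G
  intro g hg
  have hg' : g ∈ pathComponent (1 : G) := hg
  have hclopen : IsClopen (χ.ker : Set G) := ⟨χ.ker.isClosed_of_isOpen h, h⟩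
  exact hclopen.connectedComponent_subset χ.ker.one_mem (pathComponent_subset_component 1 hg')

variable [IsTopologicalAddGroup E] [ContinuousSMul ℝ E]

/-- The left invariant vector field with value `w` at `1` is differentiable at `1`, and its pairing
with the derivative of a character is the character times a constant. -/
theorem exists_hasDirDeriv_leftInvField [T2Space E] [IsLieGroup E G] (w : E) :
    leftInvField G w (chartAt E (1 : G) 1) = w ∧
    (∀ v, ∃ b, HasDirDeriv (leftInvField G w) (chartAt E (1 : G) 1) v b) ∧
    ∀ x ∈ (chartAt E (1 : G)).target, HasDirDeriv (fun y : E =>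
      chartAt E (1 : G) ((chartAt E (1 : G)).symm x * (chartAt E (1 : G)).symm y))
      (chartAt E (1 : G) 1) w (leftInvField G w x) := by
  set e := chartAt E (1 : G)
  have hea : e ∈ atlas E G := chart_mem_atlas E (1 : G)
  have h1 : (1 : G) ∈ e.source := mem_chart_source E 1
  have hx0 : e 1 ∈ e.target := e.map_source h1
  have hs1 : e.symm (e 1) = 1 := e.left_inv h1
  obtain ⟨hV, hm⟩ := smoothOn_mul_charts hea hea hea
  obtain ⟨-, m', hd, -, m'', hd', -⟩ := hm 2
  have hmem : ∀ x ∈ e.target, (x, e 1) ∈ {p : E × E | p.1 ∈ e.target ∧ p.2 ∈ e.target ∧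
      e.symm p.1 * e.symm p.2 ∈ e.source} := fun x hx =>
    ⟨hx, hx0, by simpa [hs1] using e.map_target hx⟩
  have hL : ∀ x ∈ e.target, HasDirDeriv (fun y : E => e (e.symm x * e.symm y)) (e 1) w
      (m' ((x, e 1), (0, w))) := fun x hx => by
    have := HasDirDeriv.comp_affine (D := E) (ContinuousLinearMap.inr ℝ E E) (x, 0)
      (f := fun p : E × E => e (e.symm p.1 * e.symm p.2)) (x := e 1) (h := w)
      (y := m' ((x, e 1), (0, w))) (by simpa using hd _ (hmem x hx) (0, w))
    simpa using this
  have hLeq : ∀ x ∈ e.target, leftInvField G w x = m' ((x, e 1), (0, w)) := fun x hx =>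
    (hL x hx).dirDeriv_eq
  refine ⟨?_, fun v => ⟨m'' (((e 1, e 1), (0, w)), ((v, 0), 0)), ?_⟩, fun x hx => ?_⟩
  · rw [hLeq _ hx0]
    refine (hL _ hx0).unique ?_
    have hid : HasDirDeriv (fun y : E => y) (e 1) w w := by
      simpa using HasDirDeriv.of_clm (ContinuousLinearMap.id ℝ E) 0 (e 1) w
    refine hid.congr_of_isOpen e.open_target (fun y hy => ?_) hx0
    simp [hs1, e.right_inv hy]
  -- The field is `x ↦ m' ((x, e 1), (0, w))`, that is, `m'` along an affine map, so no chain rule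
  -- for `E`-valued maps is needed.
  · have := HasDirDeriv.comp_affine (D := E)
      ((ContinuousLinearMap.inl ℝ (E × E) (E × E)).comp (ContinuousLinearMap.inl ℝ E E))
      ((0, e 1), (0, w)) (f := m') (x := e 1) (h := v)
      (y := m'' (((e 1, e 1), (0, w)), ((v, 0), 0)))
      (by simpa using hd' ((e 1, e 1), (0, w)) ⟨hmem _ hx0, mem_univ _⟩ ((v, 0), 0))
    refine this.congr_of_isOpen e.open_target (fun y hy => ?_) hx0
    simpa using (hLeq y hy).symm
  · rw [hLeq x hx]
    exact hL x hx

/-- The derivative at `1` of a smooth character vanishes on brackets. -/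
theorem hasDirDeriv_lieBracket_of_isSmoothMap [T2Space E] [IsLieGroup E G] {χ : G →* Circle}
    (hχ : IsSmoothMap E CircleModel χ) (v w : E) :
    HasDirDeriv (fun x => (χ ((chartAt E (1 : G)).symm x) : ℂ)) (chartAt E (1 : G) 1)
      (lieBracket G v w) 0 := by
  obtain ⟨f', f'', hd, hc, hd', hc'⟩ := exists_derivs_of_isSmoothMap hχ (chart_mem_atlas E (1 : G))
  -- Left invariance `f' (x, X_w x) = χ x * f' (1, w)` is differentiated at `1` along `v`. As `f'`
  -- is linear in its second argument, the left side contributes `f'' ((1, w), (v, 0)) + f' (1, b)`.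
  have key : ∀ v w b, HasDirDeriv (leftInvField G w) (chartAt E (1 : G) 1) v b →
      f' (chartAt E (1 : G) 1, b) =
        f' (chartAt E (1 : G) 1, v) * f' (chartAt E (1 : G) 1, w)
          - f'' ((chartAt E (1 : G) 1, w), (v, 0)) := by
    intro v w b hb
    obtain ⟨hw, -, hmul⟩ := exists_hasDirDeriv_leftInvField (G := G) w
    set e := chartAt E (1 : G)
    have hea : e ∈ atlas E G := chart_mem_atlas E (1 : G)
    have h1 : (1 : G) ∈ e.source := mem_chart_source E 1
    have hx0 : e 1 ∈ e.target := e.map_source h1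
    have hs1 : e.symm (e 1) = 1 := e.left_inv h1
    obtain ⟨hV, -⟩ := smoothOn_mul_charts hea hea hea
    have hinv : ∀ x ∈ e.target, f' (x, leftInvField G w x) =
        (χ (e.symm x) : ℂ) * f' (e 1, w) := by
      intro x hx
      have hmx : e (e.symm x * e.symm (e 1)) = x := by simp [hs1, e.right_inv hx]
      have hl := HasDirDeriv.comp e.open_target hd hc
        (g := fun y => e (e.symm x * e.symm y)) (by rwa [hmx]) (hmul x hx)
      rw [hmx] at hl
      refine hl.unique ?_
      have hr := (hd _ hx0 w).clm_comp (ContinuousLinearMap.mul ℝ ℂ (χ (e.symm x)))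
      refine hr.congr_of_isOpen (hV.preimage (Continuous.prodMk_right x)) (fun y hy => ?_)
        ⟨hx, hx0, by simpa [hs1] using e.map_target hx⟩
      have hy3 : e.symm x * e.symm y ∈ e.source := hy.2.2
      simp [e.left_inv hy3]
    have hl : HasDirDeriv (fun x => f' (x, leftInvField G w x)) (e 1) v
        (f'' ((e 1, w), (v, b))) := by
      have hid : HasDirDeriv (fun y : E => y) (e 1) v v := by
        simpa using HasDirDeriv.of_clm (ContinuousLinearMap.id ℝ E) 0 (e 1) v
      have := HasDirDeriv.comp (e.open_target.prod isOpen_univ) hd' hc' (x := e 1)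
        (g := fun x => (x, leftInvField G w x)) ⟨hx0, mem_univ _⟩ (hid.prodMk hb)
      simpa only [hw] using this
    have hr : HasDirDeriv (fun x => f' (x, leftInvField G w x)) (e 1) v
        (f' (e 1, v) * f' (e 1, w)) := by
      refine ((hd _ hx0 v).clm_comp
        ((ContinuousLinearMap.mul ℝ ℂ).flip (f' (e 1, w)))).congr_of_isOpen e.open_target
          (fun x hx => ?_) hx0
      simp [hinv x hx, mul_comm]
    have hadd := HasDirDeriv.map_add_of_continuousOn (e.open_target.prod isOpen_univ) hd' hc'
      (x := (e 1, w)) ⟨hx0, mem_univ _⟩ (v, 0) (0, b)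
    have hb2 : f'' ((e 1, w), (0, b)) = f' (e 1, b) := by
      refine (hd' (e 1, w) ⟨hx0, mem_univ _⟩ (0, b)).unique ?_
      refine Tendsto.congr' ?_ tendsto_const_nhds
      filter_upwards [self_mem_nhdsWithin] with t ht
      have ht : t ≠ 0 := ht
      have h3 : f' (e 1, w + t • b) = f' (e 1, w) + t • f' (e 1, b) := by
        rw [HasDirDeriv.map_add_of_continuousOn e.open_target hd hc hx0,
          (hd _ hx0 (t • b)).unique ((hd _ hx0 b).smul_dir t)]
      simp only [Prod.smul_mk, smul_zero, Prod.mk_add_mk, add_zero, h3, add_sub_cancel_left,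
        smul_smul, inv_mul_cancel₀ ht, one_smul]
    rw [← hl.unique hr, eq_sub_iff_add_eq, add_comm, ← hb2]
    simpa using hadd.symm
  obtain ⟨b, hb⟩ := (exists_hasDirDeriv_leftInvField (G := G) w).2.1 v
  obtain ⟨b', hb'⟩ := (exists_hasDirDeriv_leftInvField (G := G) v).2.1 w
  have hx0 : chartAt E (1 : G) 1 ∈ (chartAt E (1 : G)).target :=
    (chartAt E (1 : G)).map_source (mem_chart_source E 1)
  have hbr : lieBracket G v w = b + (-1 : ℝ) • b' := by
    rw [lieBracket, hb.dirDeriv_eq, hb'.dirDeriv_eq, neg_one_smul, sub_eq_add_neg]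
  -- In the difference of the two instances of `key` the products cancel by commutativity and the
  -- second derivatives by symmetry.
  have h0 : f' (chartAt E (1 : G) 1, lieBracket G v w) = 0 := by
    rw [hbr, HasDirDeriv.map_add_of_continuousOn (chartAt E (1 : G)).open_target hd hc hx0,
      (hd _ hx0 ((-1 : ℝ) • b')).unique ((hd _ hx0 b').smul_dir (-1)), key v w b hb,
      key w v b' hb', second_dirDeriv_symm (chartAt E (1 : G)).open_target hd hd' hc' hx0 w v,
      neg_one_smul]
    ring
  rw [← h0]
  exact hd _ hx0 _

/-- A smooth character of a Lie group with topologically perfect Lie algebra has vanishing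
derivative at `1`. -/
theorem hasDirDeriv_one_of_isTopologicallyPerfect [T2Space E] [IsLieGroup E G]
    (hG : IsTopologicallyPerfect E G) {χ : G →* Circle} (hχ : IsSmoothMap E CircleModel χ)
    (h : E) :
    HasDirDeriv (fun x => (χ ((chartAt E (1 : G)).symm x) : ℂ)) (chartAt E (1 : G) 1) h 0 := by
  obtain ⟨f', f'', hd, hc, -, -⟩ := exists_derivs_of_isSmoothMap hχ (chart_mem_atlas E (1 : G))
  have hbr := hasDirDeriv_lieBracket_of_isSmoothMap hχ
  set e := chartAt E (1 : G)
  have hx0 : e 1 ∈ e.target := e.map_source (mem_chart_source E 1)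
  let lam : E →ₗ[ℝ] ℂ :=
    { toFun := fun h => f' (e 1, h)
      map_add' := HasDirDeriv.map_add_of_continuousOn e.open_target hd hc hx0
      map_smul' := fun a h => (hd _ hx0 (a • h)).unique ((hd _ hx0 h).smul_dir a) }
  have hlam : Continuous lam :=
    hc.comp_continuous (f := fun h => (e 1, h)) (by fun_prop) fun h => ⟨hx0, mem_univ _⟩
  have hspan : Submodule.span ℝ {x : E | ∃ v w : E, x = lieBracket G v w} ≤ LinearMap.ker lam := by
    refine Submodule.span_le.2 ?_
    rintro _ ⟨v, w, rfl⟩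
    exact (hd _ hx0 _).unique (hbr v w)
  have h0 : lam h = 0 := by
    have : (lam : E → ℂ) = fun _ => 0 :=
      hlam.ext_on hG continuous_const fun x hx => hspan hx
    exact congrFun this h
  rw [← h0]
  exact hd _ hx0 h

/-- If the derivative at `1` of a smooth character vanishes, then it vanishes at all points of the
chart at `1`. -/
theorem hasDirDeriv_zero_of_one [IsLieGroup E G] {χ : G →* Circle}
    (hχ : IsSmoothMap E CircleModel χ)
    (h1 : ∀ h, HasDirDeriv (fun x => (χ ((chartAt E (1 : G)).symm x) : ℂ))
      (chartAt E (1 : G) 1) h 0) {x : E} (hx : x ∈ (chartAt E (1 : G)).target) (h : E) :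
    HasDirDeriv (fun x => (χ ((chartAt E (1 : G)).symm x) : ℂ)) x h 0 := by
  obtain ⟨f', f'', hd, hc, -, -⟩ := exists_derivs_of_isSmoothMap hχ (chart_mem_atlas E (1 : G))
  set e := chartAt E (1 : G)
  have hea : e ∈ atlas E G := chart_mem_atlas E (1 : G)
  have h1s : (1 : G) ∈ e.source := mem_chart_source E 1
  have hx0 : e 1 ∈ e.target := e.map_source h1s
  -- Left translation by `a` carries the point to `1` and changes `χ` by a constant factor. Since
  -- `a` may lie outside the chart at `1`, it gets its own chart `c`.
  set a : G := (e.symm x)⁻¹ with ha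
  set c := chartAt E a
  have hca : a ∈ c.source := mem_chart_source E a
  obtain ⟨hV, hm⟩ := smoothOn_mul_charts (chart_mem_atlas E a : c ∈ atlas E G) hea hea
  obtain ⟨-, m', hmd, -⟩ := hm 1
  have hax : c.symm (c a) * e.symm x = 1 := by rw [c.left_inv hca, ha, inv_mul_cancel]
  have hmem : (c a, x) ∈ {p : E × E | p.1 ∈ c.target ∧ p.2 ∈ e.target ∧
      c.symm p.1 * e.symm p.2 ∈ e.source} :=
    ⟨c.map_source hca, hx, by simpa only [hax] using h1s⟩
  have hg : HasDirDeriv (fun y : E => e (c.symm (c a) * e.symm y)) x h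
      (m' ((c a, x), (0, h))) := by
    have := HasDirDeriv.comp_affine (D := E) (ContinuousLinearMap.inr ℝ E E) (c a, 0)
      (f := fun p : E × E => e (c.symm p.1 * e.symm p.2)) (x := x) (h := h)
      (y := m' ((c a, x), (0, h))) (by simpa using hmd _ hmem (0, h))
    simpa using this
  have hl := HasDirDeriv.comp e.open_target hd hc
    (g := fun y => e (c.symm (c a) * e.symm y)) (by rwa [hax]) hg
  rw [hax, (hd _ hx0 _).unique (h1 _)] at hl
  have hr := hl.clm_comp (ContinuousLinearMap.mul ℝ ℂ (χ (e.symm x)))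
  rw [map_zero] at hr
  refine hr.congr_of_isOpen (hV.preimage (Continuous.prodMk_right (c a))) (fun y hy => ?_) hmem
  have hy3 : c.symm (c a) * e.symm y ∈ e.source := hy.2.2
  rw [ContinuousLinearMap.mul_apply', e.left_inv hy3, c.left_inv hca, ha, ← Circle.coe_mul,
    ← map_mul, mul_inv_cancel_left]

/-- A smooth character of a Lie group with topologically perfect Lie algebra has open kernel. -/
theorem isOpen_ker_of_isTopologicallyPerfect [LocallyConvexSpace ℝ E] [T2Space E] [IsLieGroup E G]
    (hG : IsTopologicallyPerfect E G) {χ : G →* Circle} (hχ : IsSmoothMap E CircleModel χ) :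
    IsOpen (χ.ker : Set G) := by
  have := IsLieGroup.isTopologicalGroup E G
  have hzero := fun x hx => hasDirDeriv_zero_of_one hχ
    (hasDirDeriv_one_of_isTopologicallyPerfect hG hχ) (x := x) hx
  set e := chartAt E (1 : G)
  have h1s : (1 : G) ∈ e.source := mem_chart_source E 1
  have hx0 : e 1 ∈ e.target := e.map_source h1s
  -- Local convexity keeps the segments from `e 1` inside the chart, and `χ` is constant along them.
  obtain ⟨S, hS, hconv, hSe⟩ := (locallyConvexSpace_iff_exists_convex_subset ℝ E).1 inferInstance
    (e 1) e.target (e.open_target.mem_nhds hx0)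
  have hone : ∀ y ∈ S, χ (e.symm y) = 1 := by
    intro y hy
    have hseg : ∀ t ∈ Icc (0 : ℝ) 1, e 1 + t • (y - e 1) ∈ S := fun t ht =>
      hconv.add_smul_sub_mem (mem_of_mem_nhds hS) hy ht
    have hder : ∀ t ∈ Icc (0 : ℝ) 1, HasDerivWithinAt
        (fun t : ℝ => (χ (e.symm (e 1 + t • (y - e 1))) : ℂ)) 0 (Icc 0 1) t := fun t ht =>
      (hasDerivAt_line (f := fun x => (χ (e.symm x) : ℂ))
        (hzero _ (hSe (hseg t ht)) (y - e 1))).hasDerivWithinAt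
    have := Convex.norm_image_sub_le_of_norm_hasDerivWithin_le (C := 0) hder (by simp)
      (convex_Icc 0 1) (left_mem_Icc.2 zero_le_one) (right_mem_Icc.2 zero_le_one)
    simp only [one_smul, add_sub_cancel, zero_smul, add_zero, zero_mul, norm_le_zero_iff,
      sub_eq_zero, e.left_inv h1s, map_one] at this
    exact Circle.ext this
  refine Subgroup.isOpen_of_mem_nhds _ (g := 1) ?_
  filter_upwards [e.open_source.mem_nhds h1s, (e.continuousAt h1s).preimage_mem_nhds hS]
    with g hg hgS
  have := hone _ hgS
  rwa [e.left_inv hg] at this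

end Perfect

end LCLie

theorem proposition4p8
    {E' E G' G H H' : Type*}
    [AddCommGroup E'] [Module ℝ E'] [TopologicalSpace E'] [IsTopologicalAddGroup E']
    [ContinuousSMul ℝ E'] [LocallyConvexSpace ℝ E'] [T2Space E']
    [AddCommGroup E] [Module ℝ E] [TopologicalSpace E] [IsTopologicalAddGroup E]
    [ContinuousSMul ℝ E] [LocallyConvexSpace ℝ E] [T2Space E]
    [TopologicalSpace G'] [ChartedSpace E' G'] [Group G'] [IsLieGroup E' G']
    [TopologicalSpace G] [ChartedSpace E G] [Group G] [IsLieGroup E G]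
    [NormedAddCommGroup H] [InnerProductSpace ℂ H] [CompleteSpace H]
    [NormedAddCommGroup H'] [InnerProductSpace ℂ H'] [CompleteSpace H']
    (X : CentralExtension E' E G' G)
    (ρ : G' →* (H ≃ₗᵢ[ℂ] H)) (ρ' : G' →* (H' ≃ₗᵢ[ℂ] H'))
    (hρs : IsSmoothRep E' ρ) (hρs' : IsSmoothRep E' ρ')
    (hρ : ∀ (z : Circle) (ψ : H), ρ (X.incl z) ψ = (z : ℂ) • ψ)
    (hρ' : ∀ (z : Circle) (ψ : H'), ρ' (X.incl z) ψ = (z : ℂ) • ψ) :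
    (ProjEquivalent (projRep X ρ hρ) (projRep X ρ' hρ') ↔
      ∃ (U : H ≃ₗᵢ[ℂ] H') (χ : G →* Circle), IsSmoothMap E CircleModel χ ∧
        ∀ (x : G') (ψ : H'), ρ' x ψ = (χ (X.proj x) : ℂ) • U (ρ x (U.symm ψ))) ∧
    (IsTopologicallyPerfect E G →
      ∀ χ : G →* Circle, IsSmoothMap E CircleModel χ →
        ∃ χ₀ : PiZero E G →* Circle, ∀ g : G, χ g = χ₀ (QuotientGroup.mk g)) := by
  refine ⟨?_, fun hG χ hχ => ⟨QuotientGroup.lift _ χ (identityComponent_le_ker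
    (isOpen_ker_of_isTopologicallyPerfect hG hχ)), fun g => rfl⟩⟩
  rw [projEquivalent_projRep_iff]
  refine exists_congr fun U => ⟨fun hU => ?_, ?_⟩
  -- On the zero space the scalars are not determined and need not form a character; the trivial one
  -- serves.
  · rcases subsingleton_or_nontrivial H' with hH | hH
    · exact ⟨1, IsSmoothMap.const 1, fun x ψ => Subsingleton.elim _ _⟩
    · obtain ⟨χ, hχ⟩ := exists_character X ρ ρ' hρ hρ' U hU
      exact ⟨χ, isSmoothMap_character X hρs hρs' hχ, hχ⟩
  · rintro ⟨χ, -, hχ⟩ x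
    exact ⟨χ (X.proj x), hχ x⟩
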